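/- Let $p$ be an odd prime, let $G$ be a finite $p$-group, and let $N$ be a normal subgroup of $G$. Assume that $N$ is powerful, that is, $[N,N]\subseteq N^p$, where $N^p$ is the subgroup generated by the $p$-th powers of the elements of $N$. Then $$\exp(N\wedge G)\ \mid\ \exp(N).$$ Here, writing ${}^{x}y=xyx^{-1}$, the nonabelian tensor product $N\otimes G$ is the group generated by the symbols $n\otimes g$ ($n\in N$, $g\in G$) subject to the relations $$nn'\otimes g=({}^{n}n'\otimes{}^{n}g)(n\otimes g),\qquad n\otimes gg'=(n\otimes g)({}^{g}n\otimes{}^{g}g')$$ for all $n,n'\in N$ and $g,g'\in G$. The nonabelian exterior product $N\wedge G$ is the quotient of $N\otimes G$ by the normal subgroup generated by the elements $x\otimes x$ with $x\in N$. Further, $\exp$ denotes the exponent of a group; in particular, $N\wedge G$ has finite exponent. -/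

import Mathlib

/-- The subgroup `G ^ n` of `G` generated by the `n`-th powers of the elements of `G`. -/
def powSubgroup (G : Type*) [Group G] (n : ℕ) : Subgroup G :=
  Subgroup.closure (Set.range fun g : G => g ^ n)

/-- A powerful `p`-group: a `p`-group whose commutator subgroup is contained in `G ^ p` if `p` is
odd, and in `G ^ 4` if `p = 2`. -/
def IsPowerfulPGroup (p : ℕ) (G : Type*) [Group G] : Prop :=
  IsPGroup p G ∧ commutator G ≤ powSubgroup G (if p = 2 then 4 else p)

section Exterior

variable {G : Type*} [Group G] (M N : Subgroup G) [M.Normal] [N.Normal]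

/-- The relators of the nonabelian tensor product of two normal subgroups `M`, `N` of `G`, acting
on each other and on themselves by conjugation `ᵍx = g x g⁻¹` in `G`. The pair `(m, n)` is the
symbol `m ⊗ n`, and the relations are `m m' ⊗ n = (ᵐm' ⊗ ᵐn) (m ⊗ n)` and
`m ⊗ n n' = (m ⊗ n) (ⁿm ⊗ ⁿn')`. -/
inductive TensorRelator : FreeGroup (M × N) → Prop
  | left (m m' : M) (n : N) : TensorRelator
      (FreeGroup.of (m * m', n) *
        (FreeGroup.of (MulAut.conjNormal (m : G) m', MulAut.conjNormal (m : G) n) *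
          FreeGroup.of (m, n))⁻¹)
  | right (m : M) (n n' : N) : TensorRelator
      (FreeGroup.of (m, n * n') *
        (FreeGroup.of (m, n) *
          FreeGroup.of (MulAut.conjNormal (n : G) m, MulAut.conjNormal (n : G) n'))⁻¹)

/-- The nonabelian tensor product `M ⊗ N` of two normal subgroups of `G`. -/
abbrev NonabelianTensor : Type _ :=
  PresentedGroup {r : FreeGroup (M × N) | TensorRelator M N r}

variable {M N} in
/-- The generator `m ⊗ n` of `M ⊗ N`. -/
def NonabelianTensor.tmul (m : M) (n : N) : NonabelianTensor M N :=
  PresentedGroup.of (m, n)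

/-- The normal subgroup of `M ⊗ N` generated by the elements `x ⊗ x` with `x ∈ M ∩ N`. -/
def NonabelianTensor.diagonal : Subgroup (NonabelianTensor M N) :=
  Subgroup.normalClosure
    {t | ∃ (x : G) (hM : x ∈ M) (hN : x ∈ N), t = NonabelianTensor.tmul ⟨x, hM⟩ ⟨x, hN⟩}

instance : (NonabelianTensor.diagonal M N).Normal :=
  Subgroup.normalClosure_normal

/-- The nonabelian exterior product `M ∧ N` of two normal subgroups of `G`. -/
abbrev NonabelianExterior : Type _ :=
  NonabelianTensor M N ⧸ NonabelianTensor.diagonal M N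

end Exterior

/-! Put N_0 = N and let N_{i+1} be generated by the p-th powers of N_i (`powersSeries`). As p is odd
and N is powerful, [N_i, N] ≤ N_{i+1}, and each element of N_i is, modulo N_{i+1}, the p^i-th power
of an element of N. So if exp(N) = p^e, then N_e ≤ N_{e+1} = (N_e)^p, which forces N_e = 1 in a
finite p-group.

Let E_i ≤ N ∧ G be generated by the n ∧ g with n ∈ N_i (`span`). Since E_0 is everything and E_e =
1, it suffices that t ∈ E_i implies t^p ∈ E_{i+1} (`pow_mem_span`). Modulo E_{i+1}, the elements x ∧
y with x, y ∈ N_i are central and killed by p. The crossed module identity [s, t] = ∂s ∧ ∂t then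
gives E_i class at most two with commutators killed by p, and x^p ∧ g = (x ∧ [x, g])^(p choose 2) (x
∧ g)^p kills the p-th powers of generators. Since p divides (p choose 2), p-th powers are
multiplicative there. -/

open scoped commutatorElement

/-! ### Power formulas in class two -/

/-- The class-two power formula: if `x * a = z * (a * x)` with `z` commuting with `a` and `x`, then
`(a * x) ^ k = a ^ k * x ^ k * z ^ (k choose 2)`. -/
theorem mul_pow_of_commute_commutator {Q : Type*} [Group Q] {a x z : Q} (h : x * a = z * (a * x))
    (hza : Commute z a) (hzx : Commute z x) (k : ℕ) :
    (a * x) ^ k = a ^ k * x ^ k * z ^ (k.choose 2) := by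
  have hk : ∀ k : ℕ, x ^ k * a = z ^ k * (a * x ^ k) := by
    intro k
    induction k with
    | zero => simp
    | succ k ih =>
      calc x ^ (k + 1) * a = x ^ k * (x * a) := by rw [pow_succ]; group
        _ = x ^ k * z * (a * x) := by rw [h]; group
        _ = z * (x ^ k * a) * x := by rw [← (hzx.pow_right k).eq]; group
        _ = z ^ (k + 1) * (a * x ^ (k + 1)) := by rw [ih, pow_succ' z, pow_succ x]; group
  induction k with
  | zero => simp
  | succ k ih =>
    have hz : ∀ m n : ℕ, Commute (z ^ m) (a ^ n) := fun m n => hza.pow_pow m n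
    have hz' : ∀ m n : ℕ, Commute (z ^ m) (x ^ n) := fun m n => hzx.pow_pow m n
    have hc : (k + 1).choose 2 = k + k.choose 2 := by
      rw [Nat.choose_succ_succ' k 1, Nat.choose_one_right]
    have hax : Commute (z ^ (k.choose 2)) (a * x) :=
      (hza.pow_left _).mul_right (hzx.pow_left _)
    calc (a * x) ^ (k + 1) = a ^ k * x ^ k * (z ^ (k.choose 2) * (a * x)) := by
          rw [pow_succ, ih]; group
      _ = a ^ k * (x ^ k * a) * x * z ^ (k.choose 2) := by rw [hax.eq]; group
      _ = a ^ k * (z ^ k * (a * x ^ k)) * x * z ^ (k.choose 2) := by rw [hk]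
      _ = a ^ k * a * (z ^ k * (x ^ k * x)) * z ^ (k.choose 2) := by
          rw [← mul_assoc (z ^ k) a, (hza.pow_left k).eq]; group
      _ = a ^ (k + 1) * x ^ (k + 1) * z ^ ((k + 1).choose 2) := by
          rw [← pow_succ x, (hz' k (k + 1)).eq, ← pow_succ a, hc, pow_add]; group

/-- Conjugation by `x` sends `a` to `z * a`, hence `a ^ k` to `z ^ k * a ^ k`. -/
theorem commutator_pow_eq_one {Q : Type*} [Group Q] {a x z : Q} (h : x * a = z * (a * x))
    (hza : Commute z a) {k : ℕ} (hak : a ^ k = 1) : z ^ k = 1 := by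
  have hk : ∀ k : ℕ, x * a ^ k = z ^ k * a ^ k * x := by
    intro k
    induction k with
    | zero => simp
    | succ k ih =>
      calc x * a ^ (k + 1) = (x * a ^ k) * a := by rw [pow_succ]; group
        _ = z ^ k * a ^ k * (x * a) := by rw [ih]; group
        _ = z ^ k * (z * a ^ k) * (a * x) := by rw [h, (hza.pow_right k).eq]; group
        _ = z ^ (k + 1) * a ^ (k + 1) * x := by rw [pow_succ, pow_succ]; group
  have := hk k
  rw [hak] at this
  simpa using this.symm

/-- For `p` odd, `p` divides `p.choose 2`; this is how oddness enters the power formulas. -/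
theorem pow_choose_two_eq_one {Q : Type*} [Group Q] {z : Q} {p : ℕ} (hp2 : Odd p)
    (hz : z ^ p = 1) : z ^ (p.choose 2) = 1 := by
  obtain ⟨m, rfl⟩ := hp2
  have : (2 * m + 1).choose 2 = (2 * m + 1) * m := by
    rw [Nat.choose_two_right]
    have : (2 * m + 1) * (2 * m + 1 - 1) = (2 * m + 1) * m * 2 := by
      rw [Nat.add_sub_cancel]; ring
    rw [this, Nat.mul_div_cancel _ (by norm_num)]
  rw [this, pow_mul, hz, one_pow]

/-! ### The power series of a powerful normal subgroup -/

namespace Subgroup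

variable {G : Type*} [Group G]

/-- The subgroup generated by the `p`-th powers of the elements of a subgroup. -/
def powers (p : ℕ) (H : Subgroup G) : Subgroup G := closure ((fun x => x ^ p) '' (H : Set G))

theorem pow_mem_powers {p : ℕ} {H : Subgroup G} {x : G} (hx : x ∈ H) : x ^ p ∈ H.powers p :=
  subset_closure ⟨x, hx, rfl⟩

theorem powers_le_iff {p : ℕ} {H K : Subgroup G} : H.powers p ≤ K ↔ ∀ x ∈ H, x ^ p ∈ K := by
  rw [powers, closure_le]
  exact ⟨fun h x hx => h ⟨x, hx, rfl⟩, by rintro h _ ⟨x, hx, rfl⟩; exact h x hx⟩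

theorem powers_le (p : ℕ) (H : Subgroup G) : H.powers p ≤ H :=
  powers_le_iff.2 fun _ hx => pow_mem hx p

theorem map_powers {Q : Type*} [Group Q] (f : G →* Q) (p : ℕ) (H : Subgroup G) :
    (H.powers p).map f = (H.map f).powers p := by
  rw [powers, powers, MonoidHom.map_closure]
  congr 1
  ext y
  simp [Set.mem_image]

instance powers_normal (p : ℕ) (H : Subgroup G) [hH : H.Normal] : (H.powers p).Normal := by
  rw [normal_iff_map_conj_eq]
  intro g
  rw [map_powers, normal_iff_map_conj_eq.1 hH g]

/-- Iterated subgroups of `p`-th powers. -/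
def powersSeries (p : ℕ) (H : Subgroup G) : ℕ → Subgroup G
  | 0 => H
  | i + 1 => (powersSeries p H i).powers p

instance powersSeries_normal (p : ℕ) (H : Subgroup G) [hH : H.Normal] (i : ℕ) :
    (H.powersSeries p i).Normal := by
  induction i with
  | zero => exact hH
  | succ i ih => exact powers_normal p _

theorem powersSeries_antitone (p : ℕ) (H : Subgroup G) : Antitone (H.powersSeries p) :=
  antitone_nat_of_succ_le fun _ => powers_le p _

theorem powersSeries_le (p : ℕ) (H : Subgroup G) (i : ℕ) : H.powersSeries p i ≤ H :=
  H.powersSeries_antitone p (Nat.zero_le i)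

theorem map_eq_bot_of_le_ker {Q : Type*} [Group Q] {f : G →* Q} {H : Subgroup G}
    (h : H ≤ f.ker) : H.map f = ⊥ := (map_eq_bot_iff H).2 h

/-- A conjugate of `x ∈ H` by `g ∈ N` is `a * x` with `a = ⁅g, x⁆` in `H.powers p`, so `a ^ p = 1`.
As `⁅x, a⁆` centralizes `N` and is killed by `p`, the class-two formula gives `(a * x) ^ p = x ^ p`.
-/
theorem commutator_powers_eq_bot {p : ℕ} (hp2 : Odd p) {H N : Subgroup G} (hHN : H ≤ N)
    (hpe : ⁅H, N⁆ ≤ H.powers p) (hpp : (H.powers p).powers p = ⊥)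
    (hc : ⁅⁅H.powers p, N⁆, N⁆ = ⊥) : ⁅H.powers p, N⁆ = ⊥ := by
  rw [commutator_eq_bot_iff_le_centralizer, powers_le_iff]
  intro x hx
  rw [mem_centralizer_iff]
  intro g hg
  have hcen : ∀ a ∈ H.powers p, ∀ y ∈ N, ∀ w ∈ N, Commute ⁅a, y⁆ w := by
    intro a ha y hy w hw
    have h1 := commutator_eq_bot_iff_le_centralizer.1 hc (commutator_mem_commutator ha hy)
    exact (mem_centralizer_iff.1 h1 w hw).symm
  have hpow : ∀ a ∈ H.powers p, a ^ p = 1 := fun a ha => by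
    have := pow_mem_powers (p := p) ha
    rwa [hpp, mem_bot] at this
  set a := ⁅g, x⁆ with ha
  have haH : a ∈ H.powers p := by
    rw [commutator_comm] at hpe
    exact hpe (commutator_mem_commutator hg hx)
  have haN : a ∈ N := hHN (powers_le p H haH)
  set z := ⁅x, a⁆ with hz
  have hzc : ∀ w ∈ N, Commute z w := fun w hw => by
    have := hcen a haH x (hHN hx) w hw
    rw [hz, ← commutatorElement_inv]
    exact this.inv_left
  have hxa : x * a = z * (a * x) := by rw [hz, commutatorElement_def]; group
  have hzp : z ^ p = 1 := commutator_pow_eq_one hxa (hzc a haN) (hpow a haH)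
  have hformula := mul_pow_of_commute_commutator hxa (hzc a haN) (hzc x (hHN hx)) p
  rw [pow_choose_two_eq_one hp2 hzp, hpow a haH, one_mul, mul_one] at hformula
  have hconj : g * x * g⁻¹ = a * x := by rw [ha, commutatorElement_def]; group
  have : g * x ^ p * g⁻¹ = x ^ p := by rw [← conj_pow, hconj, hformula]
  exact mul_inv_eq_iff_eq_mul.1 this

/-- Iterating the inclusion pushes `T` into every term of the lower central series. -/
theorem eq_bot_of_le_commutator [Group.IsNilpotent G] {T N : Subgroup G} (h : T ≤ ⁅T, N⁆) :
    T = ⊥ := by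
  have hk : ∀ k, T ≤ (⊤ : Subgroup G).lowerCentralSeries k := by
    intro k
    induction k with
    | zero => simp
    | succ k ih => exact h.trans (commutator_mono ih le_top)
  obtain ⟨n, hn⟩ := nilpotent_iff_lowerCentralSeries.1 ‹Group.IsNilpotent G›
  exact le_bot_iff.1 (hn ▸ hk n)

/-- If `H` is powerfully embedded in `N`, then so is the subgroup generated by its `p`-th powers. -/
theorem commutator_powers_le [Group.IsNilpotent G] {p : ℕ} (hp2 : Odd p) {H N : Subgroup G}
    [H.Normal] [N.Normal] (hHN : H ≤ N) (hpe : ⁅H, N⁆ ≤ H.powers p) :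
    ⁅H.powers p, N⁆ ≤ (H.powers p).powers p := by
  set B := (H.powers p).powers p with hB
  set T := ⁅H.powers p, N⁆ with hT
  -- Dividing by `⁅T, N⁆ ⊔ B` creates the two triviality hypotheses of `commutator_powers_eq_bot`;
  -- nilpotency of `G ⧸ B` then removes the term `⁅T, N⁆`.
  have hTC : T ≤ ⁅T, N⁆ ⊔ B := by
    set C := ⁅T, N⁆ ⊔ B with hC
    set f := QuotientGroup.mk' C
    have hker : f.ker = C := QuotientGroup.ker_mk' C
    have key : ⁅(H.map f).powers p, N.map f⁆ = ⊥ := by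
      apply commutator_powers_eq_bot hp2 (map_mono hHN)
      · rw [← map_commutator, ← map_powers]; exact map_mono hpe
      · rw [← map_powers, ← map_powers]
        exact map_eq_bot_of_le_ker (le_sup_right.trans hker.ge)
      · rw [← map_powers, ← map_commutator, ← map_commutator]
        exact map_eq_bot_of_le_ker (le_sup_left.trans hker.ge)
    rw [← map_powers, ← map_commutator, map_eq_bot_iff, hker] at key
    exact key
  set f := QuotientGroup.mk' B
  have hker : f.ker = B := QuotientGroup.ker_mk' B
  have : T.map f ≤ ⁅T.map f, N.map f⁆ := by
    have := map_mono (f := f) hTC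
    rw [map_sup, map_eq_bot_of_le_ker hker.ge, sup_bot_eq] at this
    exact this.trans (map_commutator _ _ f).le
  have h1 := eq_bot_of_le_commutator this
  rwa [map_eq_bot_iff, hker] at h1

theorem commutator_powersSeries_le [Group.IsNilpotent G] {p : ℕ} (hp2 : Odd p) {N : Subgroup G}
    [N.Normal] (hN : ⁅N, N⁆ ≤ N.powers p) (i : ℕ) :
    ⁅N.powersSeries p i, N⁆ ≤ N.powersSeries p (i + 1) := by
  induction i with
  | zero => exact hN
  | succ i ih => exact commutator_powers_le hp2 (N.powersSeries_le p i) ih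

/-- A nontrivial finite `p`-group has a normal subgroup of index `p`, which contains all `p`-th
powers. -/
theorem eq_bot_of_le_powers [Finite G] {p : ℕ} (hp : p.Prime) (hG : IsPGroup p G) {H : Subgroup G}
    (h : H ≤ H.powers p) : H = ⊥ := by
  have := Fact.mk hp
  obtain ⟨n, hn⟩ := (IsPGroup.iff_card.1 (hG.to_subgroup H))
  rcases n with _ | n
  · exact eq_bot_of_card_eq H (by simpa using hn)
  exfalso
  obtain ⟨K, hK⟩ := Sylow.exists_subgroup_card_pow_prime (G := H) p (n := n)
    (by rw [hn]; exact pow_dvd_pow p (Nat.le_succ n))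
  have hidx : K.index = p := by
    have := K.card_mul_index
    rw [hK, hn, pow_succ] at this
    exact Nat.eq_of_mul_eq_mul_left (pow_pos hp.pos n) this
  have hKn : K.Normal := normal_of_index_eq_minFac_card (by
    rw [hidx, hn, hp.pow_minFac (Nat.succ_ne_zero n)])
  have hle : H.powers p ≤ K.map H.subtype := powers_le_iff.2 fun x hx => by
    refine ⟨(⟨x, hx⟩ : H) ^ p, ?_, rfl⟩
    rw [SetLike.mem_coe, ← QuotientGroup.eq_one_iff, QuotientGroup.mk_pow, ← hidx, index,
      pow_card_eq_one']
  have h2 := card_le_of_le (h.trans hle)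
  rw [card_map_of_injective H.subtype_injective, hK, hn] at h2
  exact absurd h2 (not_le.2 (Nat.pow_lt_pow_right hp.one_lt (Nat.lt_succ_self n)))

/-- Modulo `(M.powers p).powers p`, commutators of `M` are central in `M` and killed by `p`. -/
theorem mul_pow_mod_powers {p : ℕ} (hp2 : Odd p) {M : Subgroup G} [M.Normal]
    (h1 : ⁅M, M⁆ ≤ M.powers p) (h2 : ⁅M.powers p, M⁆ ≤ (M.powers p).powers p) {x y : G}
    (hx : x ∈ M) (hy : y ∈ M) :
    QuotientGroup.mk' ((M.powers p).powers p) ((x * y) ^ p) =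
      QuotientGroup.mk' ((M.powers p).powers p) (x ^ p * y ^ p) := by
  set f := QuotientGroup.mk' ((M.powers p).powers p)
  have hone : ∀ w ∈ (M.powers p).powers p, f w = 1 := fun w hw =>
    (QuotientGroup.eq_one_iff w).2 hw
  set z := ⁅y, x⁆ with hz
  have hzL : z ∈ M.powers p := h1 (commutator_mem_commutator hy hx)
  have hcomm : ∀ w ∈ M, Commute (f z) (f w) := fun w hw => by
    rw [← commutatorElement_eq_one_iff_commute, ← map_commutatorElement]
    exact hone _ (h2 (commutator_mem_commutator hzL hw))
  have hyx : f y * f x = f z * (f x * f y) := by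
    rw [← map_mul, ← map_mul, ← map_mul, hz, commutatorElement_def]; congr 1; group
  have hzp : f z ^ p = 1 := by rw [← map_pow]; exact hone _ (pow_mem_powers hzL)
  have := mul_pow_of_commute_commutator hyx (hcomm x hx) (hcomm y hy) p
  rw [pow_choose_two_eq_one hp2 hzp, mul_one] at this
  simpa using this

/-- Since `p`-th powering is multiplicative two steps down the series, products of `p`-th powers are
single `p`-th powers there; the root is then handled by induction. -/
theorem powersSeries_le_powers_mul [Group.IsNilpotent G] {p : ℕ} (hp2 : Odd p) {N : Subgroup G}
    [N.Normal] (hN : ⁅N, N⁆ ≤ N.powers p) (i : ℕ) :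
    ∀ y ∈ N.powersSeries p i, ∃ x ∈ N, (x ^ p ^ i)⁻¹ * y ∈ N.powersSeries p (i + 1) := by
  induction i with
  | zero => exact fun y hy => ⟨y, hy, by simp [one_mem]⟩
  | succ i ih =>
    have h1 : ⁅N.powersSeries p i, N.powersSeries p i⁆ ≤ (N.powersSeries p i).powers p :=
      (commutator_mono le_rfl (N.powersSeries_le p i)).trans (commutator_powersSeries_le hp2 hN i)
    have h2 : ⁅(N.powersSeries p i).powers p, N.powersSeries p i⁆ ≤
        ((N.powersSeries p i).powers p).powers p :=
      (commutator_mono le_rfl (N.powersSeries_le p i)).trans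
        (commutator_powersSeries_le hp2 hN (i + 1))
    have key := fun {x y : G} => mul_pow_mod_powers (x := x) (y := y) hp2 h1 h2
    set f := QuotientGroup.mk' (((N.powersSeries p i).powers p).powers p)
    have hfe : ∀ a b : G, f a = f b ↔ a⁻¹ * b ∈ N.powersSeries p (i + 1 + 1) := fun a b =>
      QuotientGroup.eq
    have hpow : ∀ y ∈ (N.powersSeries p i).powers p, ∃ w ∈ N.powersSeries p i, f (w ^ p) = f y := by
      intro y hy
      refine closure_induction (p := fun y _ => ∃ w ∈ N.powersSeries p i, f (w ^ p) = f y)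
        ?_ ⟨1, one_mem _, by simp⟩ ?_ ?_ hy
      · rintro _ ⟨x, hx, rfl⟩; exact ⟨x, hx, rfl⟩
      · rintro a b - - ⟨u, hu, hua⟩ ⟨v, hv, hvb⟩
        exact ⟨u * v, mul_mem hu hv, by rw [key hu hv, map_mul, hua, hvb, map_mul]⟩
      · rintro a - ⟨u, hu, hua⟩
        exact ⟨u⁻¹, inv_mem hu, by rw [inv_pow, map_inv, hua, map_inv]⟩
    intro y hy
    obtain ⟨w, hw, hwy⟩ := hpow y hy
    obtain ⟨x, hx, hxw⟩ := ih w hw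
    refine ⟨x, hx, (hfe _ _).1 ?_⟩
    have hxi : x ^ p ^ i ∈ N.powersSeries p i := by
      have := mul_mem hw (inv_mem (N.powersSeries_antitone p (Nat.le_succ i) hxw))
      simpa using this
    -- The error factor lies in the next term of the series, so its `p`-th power dies modulo the
    -- term after that.
    have h3 : w = x ^ p ^ i * ((x ^ p ^ i)⁻¹ * w) := by group
    have h4 : f (((x ^ p ^ i)⁻¹ * w) ^ p) = 1 :=
      (QuotientGroup.eq_one_iff _).2 (pow_mem_powers hxw)
    rw [← hwy, h3, key hxi (N.powersSeries_antitone p (Nat.le_succ i) hxw), map_mul, h4, mul_one,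
      ← pow_mul, ← pow_succ]

theorem powersSeries_eq_bot [Finite G] {p : ℕ} (hp : p.Prime) (hp2 : Odd p) (hG : IsPGroup p G)
    {N : Subgroup G} [N.Normal] (hN : ⁅N, N⁆ ≤ N.powers p) {e : ℕ} (he : ∀ x ∈ N, x ^ p ^ e = 1) :
    N.powersSeries p e = ⊥ := by
  have := Fact.mk hp
  have : Group.IsNilpotent G := hG.isNilpotent
  refine eq_bot_of_le_powers hp hG fun y hy => ?_
  obtain ⟨x, hx, h⟩ := powersSeries_le_powers_mul hp2 hN e y hy
  rw [he x hx, inv_one, one_mul] at h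
  exact h

end Subgroup

/-! ### Crossed module calculus of exterior pairings -/

/-- A group `E` with an action of `G`, a boundary map to `G`, and an exterior pairing
`h : N × G → E` whose values generate `E`. The values of `h` outside `N` are irrelevant. -/
structure ExteriorPairing {G : Type*} [Group G] (N : Subgroup G) (E : Type*) [Group E] where
  act : G →* Monoid.End E
  bdry : E →* G
  h : G → G → E
  mul_left : ∀ {n n' : G} (_ : n ∈ N) (_ : n' ∈ N) (g : G), h (n * n') g = act n (h n' g) * h n g
  mul_right : ∀ {n : G} (_ : n ∈ N) (g g' : G), h n (g * g') = h n g * act g (h n g')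
  act_h : ∀ (x : G) {n : G} (_ : n ∈ N) (g : G),
    act x (h n g) = h (x * n * x⁻¹) (x * g * x⁻¹)
  bdry_h : ∀ {n : G} (_ : n ∈ N) (g : G), bdry (h n g) = ⁅n, g⁆
  h_self : ∀ {n : G} (_ : n ∈ N), h n n = 1
  closure_eq : Subgroup.closure {t | ∃ n ∈ N, ∃ g, t = h n g} = ⊤

namespace ExteriorPairing

variable {G : Type*} [Group G] {N : Subgroup G} {E : Type*} [Group E] (P : ExteriorPairing N E)

theorem act_mul_apply (x y : G) (t : E) : P.act (x * y) t = P.act x (P.act y t) := by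
  rw [map_mul]; rfl

theorem act_one_apply (t : E) : P.act 1 t = t := by
  rw [map_one]; rfl

theorem act_inv_apply_act (x : G) (t : E) : P.act x⁻¹ (P.act x t) = t := by
  rw [← act_mul_apply, inv_mul_cancel, act_one_apply]

theorem act_apply_act_inv (x : G) (t : E) : P.act x (P.act x⁻¹ t) = t := by
  rw [← act_mul_apply, mul_inv_cancel, act_one_apply]

theorem closure_induction {q : E → Prop} (H : ∀ n ∈ N, ∀ g, q (P.h n g)) (h1 : q 1)
    (hmul : ∀ a b, q a → q b → q (a * b)) (hinv : ∀ a, q a → q a⁻¹) (t : E) : q t := by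
  have ht : t ∈ Subgroup.closure {t | ∃ n ∈ N, ∃ g, t = P.h n g} :=
    P.closure_eq ▸ Subgroup.mem_top t
  refine Subgroup.closure_induction (p := fun t _ => q t) ?_ h1 (fun a b _ _ => hmul a b)
    (fun a _ => hinv a) ht
  rintro _ ⟨n, hn, g, rfl⟩
  exact H n hn g

theorem one_left (g : G) : P.h 1 g = 1 := by
  have := P.mul_left (one_mem N) (one_mem N) g
  rw [mul_one, act_one_apply] at this
  exact left_eq_mul.1 this

theorem one_right {n : G} (hn : n ∈ N) : P.h n 1 = 1 := by
  have := P.mul_right hn 1 1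
  rw [mul_one, act_one_apply] at this
  exact left_eq_mul.1 this

/-- Both sides arise from expanding `P.h (n * m) (g * k)` in the two possible orders and cancelling
the outer factors. -/
theorem act_mul_h_mul {n : G} (hn : n ∈ N) (g : G) (t : E) :
    P.act (n * g) t * P.h n g = P.h n g * P.act (g * n) t := by
  refine P.closure_induction (q := fun t => P.act (n * g) t * P.h n g = P.h n g * P.act (g * n) t)
    ?_ (by simp) ?_ ?_ t
  · intro m hm k
    have e1 : P.h (n * m) (g * k) = P.act n (P.h m g) *
        (P.act (n * g) (P.h m k) * P.h n g) * P.act g (P.h n k) := by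
      rw [P.mul_left hn hm, P.mul_right hm, P.mul_right hn, map_mul, act_mul_apply]
      simp only [mul_assoc]
    have e2 : P.h (n * m) (g * k) = P.act n (P.h m g) *
        (P.h n g * P.act (g * n) (P.h m k)) * P.act g (P.h n k) := by
      rw [P.mul_right (mul_mem hn hm), P.mul_left hn hm, P.mul_left hn hm, map_mul, act_mul_apply]
      simp only [mul_assoc]
    exact mul_left_cancel (mul_right_cancel (e1.symm.trans e2))
  · intro a b ha hb
    rw [map_mul (P.act (n * g)) a b, map_mul (P.act (g * n)) a b, mul_assoc, hb, ← mul_assoc, ha,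
      mul_assoc]
  · intro a ha
    rw [map_inv, map_inv, inv_mul_eq_iff_eq_mul, ← mul_assoc, eq_mul_inv_iff_mul_eq]
    exact ha.symm

theorem act_commutator {n : G} (hn : n ∈ N) (g : G) (t : E) :
    P.act ⁅n, g⁆ t = P.h n g * t * (P.h n g)⁻¹ := by
  have := P.act_mul_h_mul hn g (P.act (g * n)⁻¹ t)
  rw [act_apply_act_inv, ← act_mul_apply] at this
  rw [eq_mul_inv_iff_mul_eq, ← this, commutatorElement_def]
  congr 3
  group

/-- The Peiffer identity. -/
theorem act_bdry (s t : E) : P.act (P.bdry s) t = s * t * s⁻¹ := by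
  refine P.closure_induction (q := fun s => ∀ t, P.act (P.bdry s) t = s * t * s⁻¹) ?_ ?_ ?_ ?_ s t
  · intro n hn g t
    rw [P.bdry_h hn, P.act_commutator hn]
  · intro t
    rw [map_one, act_one_apply]; group
  · intro a b ha hb t
    rw [map_mul, act_mul_apply, hb, ha]; group
  · intro a ha t
    have := ha (P.act (P.bdry a)⁻¹ t)
    rw [act_apply_act_inv] at this
    rw [map_inv]
    nth_rewrite 2 [this]
    group

theorem bdry_mem [N.Normal] (t : E) : P.bdry t ∈ N := by
  refine P.closure_induction (q := fun t => P.bdry t ∈ N) ?_ ?_ ?_ ?_ t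
  · intro n hn g
    rw [P.bdry_h hn]
    exact Subgroup.commutator_le_left N ⊤ (Subgroup.commutator_mem_commutator hn trivial)
  · rw [map_one]; exact one_mem N
  · intro a b ha hb
    rw [map_mul]; exact mul_mem ha hb
  · intro a ha
    rw [map_inv]; exact inv_mem ha

/-- Expand `P.h (n * m) g` directly, and again through `n * m = m * (m⁻¹ * n * m)`. -/
theorem act_h_eq [N.Normal] {n m : G} (hn : n ∈ N) (hm : m ∈ N) (g : G) :
    P.act n (P.h m g) = P.h n ⁅m, g⁆ * P.h m g := by
  have hn' : m⁻¹ * n * m ∈ N := mul_mem (mul_mem (inv_mem hm) hn) hm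
  have e1 : P.h (n * m) g = P.act n (P.h m g) * P.h n g := P.mul_left hn hm g
  have e2 : P.h (n * m) g = P.h n (m * g * m⁻¹) * P.h m g := by
    have := P.mul_left hm hn' g
    rw [P.act_h m hn'] at this
    convert this using 2 <;> group
  have e3 : P.h n (m * g * m⁻¹) = P.h n ⁅m, g⁆ * P.act ⁅m, g⁆ (P.h n g) := by
    rw [← P.mul_right hn, commutatorElement_def]
    congr 1; group
  rw [e3, P.act_commutator hm] at e2
  have := e1.symm.trans e2
  rw [← eq_mul_inv_iff_mul_eq] at this
  rw [this]; group

theorem act_eq [N.Normal] {n : G} (hn : n ∈ N) (t : E) :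
    P.act n t = P.h n (P.bdry t) * t := by
  refine P.closure_induction (q := fun t => P.act n t = P.h n (P.bdry t) * t) ?_ ?_ ?_ ?_ t
  · intro m hm g
    rw [P.act_h_eq hn hm, P.bdry_h hm]
  · rw [map_one, map_one, P.one_right hn, mul_one]
  · intro a b ha hb
    rw [map_mul, map_mul, P.mul_right hn, act_bdry, ha, hb]; group
  · intro a ha
    have h1 : P.h n (P.bdry a * P.bdry a⁻¹) = 1 := by
      rw [← map_mul, mul_inv_cancel, map_one, P.one_right hn]
    rw [P.mul_right hn, act_bdry, ← mul_assoc, ← mul_assoc, ← ha, mul_assoc] at h1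
    rw [map_inv]
    exact (eq_inv_of_mul_eq_one_right h1).symm

/-- Polarization of `h_self` at `n * m`. -/
theorem h_swap {n m : G} (hn : n ∈ N) (hm : m ∈ N) : P.h n m = (P.h m n)⁻¹ := by
  have h1 := P.h_self (mul_mem hn hm)
  rw [P.mul_left hn hm, P.mul_right hm, P.mul_right hn, P.h_self hm, P.h_self hn, map_one, mul_one,
    one_mul, ← map_mul] at h1
  have h2 := P.act_inv_apply_act n (P.h m n * P.h n m)
  rw [h1, map_one] at h2
  exact eq_inv_of_mul_eq_one_right h2.symm

/-- `P.bdry s` acts on `t` by conjugation by `s` (Peiffer) and by the formula `act_eq`; compare. -/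
theorem commutator_eq [N.Normal] (s t : E) : ⁅s, t⁆ = P.h (P.bdry s) (P.bdry t) := by
  have := P.act_eq (P.bdry_mem s) t
  rw [act_bdry] at this
  rw [commutatorElement_def, this, mul_inv_cancel_right]

/-- The subgroup generated by the values of the pairing on `M × G`. -/
def span (M : Subgroup G) : Subgroup E := Subgroup.closure {t | ∃ n ∈ M, ∃ g, t = P.h n g}

theorem h_mem_span {M : Subgroup G} {n : G} (hn : n ∈ M) (g : G) : P.h n g ∈ P.span M :=
  Subgroup.subset_closure ⟨n, hn, g, rfl⟩

theorem span_bot : P.span ⊥ = ⊥ := by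
  rw [span, Subgroup.closure_eq_bot_iff]
  rintro _ ⟨n, hn, g, rfl⟩
  rw [Subgroup.mem_bot.1 hn, P.one_left]
  rfl

theorem span_self : P.span N = ⊤ := P.closure_eq

theorem act_mem_span {M : Subgroup G} [M.Normal] (hMN : M ≤ N) (x : G) {t : E}
    (ht : t ∈ P.span M) : P.act x t ∈ P.span M := by
  have : P.span M ≤ (P.span M).comap (P.act x) := by
    refine (Subgroup.closure_le _).2 ?_
    rintro _ ⟨n, hn, g, rfl⟩
    change P.act x (P.h n g) ∈ P.span M
    rw [P.act_h x (hMN hn)]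
    exact P.h_mem_span (Subgroup.Normal.conj_mem ‹_› n hn x) _
  exact this ht

/-- Conjugation by `s` is the action of `P.bdry s`, and the span is stable under `G`. -/
theorem span_normal {M : Subgroup G} [M.Normal] (hMN : M ≤ N) : (P.span M).Normal :=
  ⟨fun t ht s => by rw [← P.act_bdry]; exact P.act_mem_span hMN _ ht⟩

theorem bdry_mem_of_mem_span {M : Subgroup G} [M.Normal] (hMN : M ≤ N) {t : E}
    (ht : t ∈ P.span M) : P.bdry t ∈ M := by
  have : P.span M ≤ M.comap P.bdry := by
    refine (Subgroup.closure_le _).2 ?_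
    rintro _ ⟨n, hn, g, rfl⟩
    change P.bdry (P.h n g) ∈ M
    rw [P.bdry_h (hMN hn)]
    exact Subgroup.commutator_le_left M ⊤ (Subgroup.commutator_mem_commutator hn trivial)
  exact this ht

/-- If `M / L` is abelian of odd exponent `p`, then the `p`-th powers of elements of the span of `M`
lie in the span of `L`. -/
theorem pow_mem_span [N.Normal] {p : ℕ} (hp2 : Odd p) {M L : Subgroup G} [M.Normal] [L.Normal]
    (hMN : M ≤ N) (hLM : L ≤ M) (hcomm : ⁅M, M⁆ ≤ L) (hpow : ∀ x ∈ M, x ^ p ∈ L) {t : E}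
    (ht : t ∈ P.span M) : t ^ p ∈ P.span L := by
  have hLN := hLM.trans hMN
  have hnormal := P.span_normal hLN
  set f := QuotientGroup.mk' (P.span L)
  have hf1 : ∀ s, f s = 1 ↔ s ∈ P.span L := fun s => QuotientGroup.eq_one_iff s
  have hbr : ∀ {x y}, x ∈ M → y ∈ M → ⁅x, y⁆ ∈ L := fun hx hy =>
    hcomm (Subgroup.commutator_mem_commutator hx hy)
  have hbrM : ∀ {x} (g), x ∈ M → ⁅x, g⁆ ∈ M := fun g hx =>
    Subgroup.commutator_le_left M ⊤ (Subgroup.commutator_mem_commutator hx trivial)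
  have hL : ∀ {l} (g), l ∈ L → f (P.h l g) = 1 := fun g hl => (hf1 _).2 (P.h_mem_span hl g)
  have hL' : ∀ {x l}, x ∈ M → l ∈ L → f (P.h x l) = 1 := fun hx hl => by
    rw [P.h_swap (hMN hx) (hLN hl), map_inv, hL _ hl, inv_one]
  have hactL : ∀ {l} (s), l ∈ L → f (P.act l s) = f s := fun s hl => by
    rw [P.act_eq (hLN hl), map_mul, hL _ hl, one_mul]
  have hactM : ∀ {x s}, x ∈ M → P.bdry s ∈ L → f (P.act x s) = f s := fun hx hs => by
    rw [P.act_eq (hMN hx), map_mul, hL' hx hs, one_mul]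
  -- values on `M × M` are central and of exponent `p` modulo the span of `L`
  have hcen : ∀ {x y}, x ∈ M → y ∈ M → ∀ s, Commute (f (P.h x y)) (f s) := fun {x y} hx hy s => by
    have h1 := P.act_bdry (P.h x y) s
    have h2 := hactL s (P.bdry_h (hMN hx) y ▸ hbr hx hy)
    rw [h1, map_mul, map_mul, map_inv, mul_inv_eq_iff_eq_mul] at h2
    exact h2
  have hpowh : ∀ {x y}, x ∈ M → y ∈ M → f (P.h x y) ^ p = 1 := fun {x y} hx hy => by
    have hk : ∀ k : ℕ, f (P.h (x ^ k) y) = f (P.h x y) ^ k := by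
      intro k
      induction k with
      | zero => simp [P.one_left]
      | succ k ih =>
        rw [pow_succ, P.mul_left (pow_mem (hMN hx) k) (hMN hx), map_mul,
          hactM (pow_mem hx k) (P.bdry_h (hMN hx) y ▸ hbr hx hy), ih, pow_succ']
    rw [← hk, hL _ (hpow x hx)]
  have hgen : ∀ x ∈ M, ∀ g, f (P.h x g) ^ p = 1 := by
    intro x hx g
    set c := P.h x ⁅x, g⁆
    set u := P.h x g
    have hc : ∀ s, Commute (f c) (f s) := hcen hx (hbrM g hx)
    have hact : ∀ k : ℕ, f (P.act (x ^ k) u) = f c ^ k * f u := by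
      intro k
      induction k with
      | zero => simp
      | succ k ih =>
        rw [pow_succ, act_mul_apply, P.act_h_eq (hMN hx) (hMN hx), map_mul, map_mul, ih,
          hactM (pow_mem hx k) (P.bdry_h (hMN hx) ⁅x, g⁆ ▸ hbr hx (hbrM g hx)), pow_succ' (f c),
          mul_assoc]
    -- Each factor `x` shifts `u` by the central `c`; the shifts 0 + 1 + ... + (k - 1) add up to the
    -- binomial coefficient.
    have hk : ∀ k : ℕ, f (P.h (x ^ k) g) = f c ^ (k.choose 2) * f u ^ k := by
      intro k
      induction k with
      | zero => simp [P.one_left]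
      | succ k ih =>
        have hch : (k + 1).choose 2 = k + k.choose 2 := by
          rw [Nat.choose_succ_succ' k 1, Nat.choose_one_right]
        rw [pow_succ, P.mul_left (pow_mem (hMN hx) k) (hMN hx), map_mul, hact, ih, hch, pow_add,
          pow_succ' (f u), mul_assoc, ← mul_assoc (f u), ← ((hc u).pow_left _).eq]
        simp only [mul_assoc]
    have := hk p
    rwa [hL _ (hpow x hx), pow_choose_two_eq_one hp2 (hpowh hx (hbrM g hx)), one_mul,
      eq_comm] at this
  rw [← hf1, map_pow]
  refine Subgroup.closure_induction (p := fun t _ => f t ^ p = 1) ?_ (by simp) ?_ ?_ ht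
  · rintro _ ⟨x, hx, g, rfl⟩
    exact hgen x hx g
  · intro a b ha hb hap hbp
    have hab := P.bdry_mem_of_mem_span hMN ha
    have hbb := P.bdry_mem_of_mem_span hMN hb
    have hz := hcen hbb hab
    have hba : f b * f a = f (P.h (P.bdry b) (P.bdry a)) * (f a * f b) := by
      rw [← P.commutator_eq, ← map_mul, ← map_mul, ← map_mul, commutatorElement_def]
      congr 1; group
    rw [map_mul, mul_pow_of_commute_commutator hba (hz a) (hz b), hap, hbp,
      pow_choose_two_eq_one hp2 (hpowh hbb hab), one_mul, one_mul]
  · intro a _ hap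
    rw [map_inv, inv_pow, hap, inv_one]

theorem pow_eq_one [Finite G] (P : ExteriorPairing N E) {p : ℕ} (hp : p.Prime) (hp2 : Odd p)
    (hG : IsPGroup p G) [N.Normal] (hN : ⁅N, N⁆ ≤ N.powers p) {e : ℕ} (he : ∀ x ∈ N, x ^ p ^ e = 1) (t : E) :
    t ^ p ^ e = 1 := by
  have := Fact.mk hp
  have : Group.IsNilpotent G := hG.isNilpotent
  have hk : ∀ i : ℕ, t ^ p ^ i ∈ P.span (N.powersSeries p i) := by
    intro i
    induction i with
    | zero => exact P.span_self ▸ Subgroup.mem_top _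
    | succ i ih =>
      rw [pow_succ, pow_mul]
      exact P.pow_mem_span hp2 (N.powersSeries_le p i)
        (N.powersSeries_antitone p (Nat.le_succ i))
        ((Subgroup.commutator_mono le_rfl (N.powersSeries_le p i)).trans
          (Subgroup.commutator_powersSeries_le hp2 hN i))
        (fun x hx => Subgroup.pow_mem_powers hx) ih
  have := hk e
  rwa [Subgroup.powersSeries_eq_bot hp hp2 hG hN he, P.span_bot, Subgroup.mem_bot] at this

end ExteriorPairing

/-! ### The exterior product as an exterior pairing -/

namespace NonabelianTensor

variable {G : Type*} [Group G] {M N : Subgroup G} [M.Normal] [N.Normal]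

theorem tmul_mul_left (m m' : M) (n : N) :
    tmul (m * m') n =
      tmul (MulAut.conjNormal (m : G) m') (MulAut.conjNormal (m : G) n) * tmul m n :=
  PresentedGroup.mk_eq_mk_of_mul_inv_mem (TensorRelator.left m m' n)

theorem tmul_mul_right (m : M) (n n' : N) :
    tmul m (n * n') =
      tmul m n * tmul (MulAut.conjNormal (n : G) m) (MulAut.conjNormal (n : G) n') :=
  PresentedGroup.mk_eq_mk_of_mul_inv_mem (TensorRelator.right m n n')

/-- Maps out of the nonabelian tensor product are given by crossed pairings. -/
def lift {Q : Type*} [Group Q] (f : M → N → Q)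
    (hl : ∀ m m' n, f (m * m') n =
      f (MulAut.conjNormal (m : G) m') (MulAut.conjNormal (m : G) n) * f m n)
    (hr : ∀ m n n', f m (n * n') =
      f m n * f (MulAut.conjNormal (n : G) m) (MulAut.conjNormal (n : G) n')) :
    NonabelianTensor M N →* Q :=
  PresentedGroup.toGroup (f := fun q : M × N => f q.1 q.2) (by
    rintro _ (⟨m, m', n⟩ | ⟨m, n, n'⟩)
    · simp only [map_mul, map_inv, FreeGroup.lift_apply_of]
      rw [hl, mul_inv_cancel]
    · simp only [map_mul, map_inv, FreeGroup.lift_apply_of]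
      rw [hr, mul_inv_cancel])

theorem lift_tmul {Q : Type*} [Group Q] (f : M → N → Q) (hl) (hr) (m : M) (n : N) :
    lift f hl hr (tmul m n) = f m n :=
  PresentedGroup.toGroup.of _

theorem hom_ext {Q : Type*} [Group Q] {f f' : NonabelianTensor M N →* Q}
    (H : ∀ m n, f (tmul m n) = f' (tmul m n)) : f = f' :=
  PresentedGroup.ext fun q => H q.1 q.2

theorem conjNormal_conj (x y : G) (m : M) :
    MulAut.conjNormal x (MulAut.conjNormal y m) =
      MulAut.conjNormal (x * y * x⁻¹) (MulAut.conjNormal x m) := by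
  ext
  simp only [MulAut.conjNormal_apply]
  group

/-- Conjugation by an element of `G` acts on the tensor product. -/
def conj (x : G) : NonabelianTensor M N →* NonabelianTensor M N :=
  lift (fun m n => tmul (MulAut.conjNormal x m) (MulAut.conjNormal x n))
    (fun m m' n => by
      rw [map_mul, tmul_mul_left, MulAut.conjNormal_apply, ← conjNormal_conj, ← conjNormal_conj])
    (fun m n n' => by
      rw [map_mul, tmul_mul_right, MulAut.conjNormal_apply, ← conjNormal_conj, ← conjNormal_conj])

theorem conj_tmul (x : G) (m : M) (n : N) :
    conj x (tmul m n) = tmul (MulAut.conjNormal x m) (MulAut.conjNormal x n) :=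
  lift_tmul _ _ _ m n

/-- The commutator map `m ⊗ n ↦ [m, n]`. -/
def bdry : NonabelianTensor M N →* G :=
  lift (fun m n => ⁅(m : G), (n : G)⁆)
    (fun m m' n => by
      simp only [commutatorElement_def, MulAut.conjNormal_apply, Subgroup.coe_mul]; group)
    (fun m n n' => by
      simp only [commutatorElement_def, MulAut.conjNormal_apply, Subgroup.coe_mul]; group)

theorem bdry_tmul (m : M) (n : N) : bdry (tmul m n) = ⁅(m : G), (n : G)⁆ :=
  lift_tmul _ _ _ m n

theorem diagonal_le_comap_conj (x : G) : diagonal M N ≤ (diagonal M N).comap (conj x) := by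
  refine Subgroup.normalClosure_le_normal ?_
  rintro _ ⟨y, hM, hN, rfl⟩
  change conj x _ ∈ diagonal M N
  rw [conj_tmul]
  exact Subgroup.subset_normalClosure
    ⟨x * y * x⁻¹, Subgroup.Normal.conj_mem ‹_› y hM x, Subgroup.Normal.conj_mem ‹_› y hN x, rfl⟩

theorem diagonal_le_ker_bdry : diagonal M N ≤ (bdry : NonabelianTensor M N →* G).ker := by
  refine Subgroup.normalClosure_le_normal ?_
  rintro _ ⟨y, hM, hN, rfl⟩
  change bdry _ = 1
  rw [bdry_tmul, commutatorElement_self]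

end NonabelianTensor

namespace NonabelianExterior

open NonabelianTensor

variable {G : Type*} [Group G]

theorem hom_ext {M N : Subgroup G} [M.Normal] [N.Normal] {Q : Type*} [Group Q]
    {f f' : NonabelianExterior M N →* Q}
    (H : ∀ m n, f (QuotientGroup.mk (tmul m n)) = f' (QuotientGroup.mk (tmul m n))) : f = f' :=
  QuotientGroup.monoidHom_ext _ (NonabelianTensor.hom_ext H)

/-- Conjugation by an element of `G` acts on the exterior product. -/
def conj {M N : Subgroup G} [M.Normal] [N.Normal] : G →* Monoid.End (NonabelianExterior M N) where
  toFun x := QuotientGroup.map _ _ (NonabelianTensor.conj x) (diagonal_le_comap_conj x)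
  map_one' := hom_ext fun m n => by
    change (QuotientGroup.mk (NonabelianTensor.conj 1 (tmul m n)) : NonabelianExterior M N) = _
    rw [conj_tmul, map_one, map_one]
    rfl
  map_mul' x y := hom_ext fun m n => by
    change (QuotientGroup.mk (NonabelianTensor.conj (x * y) (tmul m n)) : NonabelianExterior M N) =
      QuotientGroup.mk (NonabelianTensor.conj x (NonabelianTensor.conj y (tmul m n)))
    rw [conj_tmul, conj_tmul, conj_tmul, map_mul, map_mul]
    rfl

variable (N : Subgroup G) [N.Normal]

open Classical in
/-- The universal exterior pairing on `N × G`. -/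
noncomputable def pairing : ExteriorPairing N (NonabelianExterior N (⊤ : Subgroup G)) where
  act := conj
  bdry := QuotientGroup.lift _ NonabelianTensor.bdry diagonal_le_ker_bdry
  h n g := if hn : n ∈ N then
    QuotientGroup.mk (tmul ⟨n, hn⟩ (⟨g, trivial⟩ : (⊤ : Subgroup G))) else 1
  mul_left {n n'} hn hn' g := by
    rw [dif_pos (mul_mem hn hn'), dif_pos hn, dif_pos hn']
    change _ = QuotientGroup.mk (NonabelianTensor.conj n _) * _
    rw [conj_tmul, ← QuotientGroup.mk_mul]
    exact congrArg _ (tmul_mul_left (⟨n, hn⟩ : N) ⟨n', hn'⟩ (⟨g, trivial⟩ : (⊤ : Subgroup G)))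
  mul_right {n} hn g g' := by
    rw [dif_pos hn, dif_pos hn, dif_pos hn]
    change _ = _ * QuotientGroup.mk (NonabelianTensor.conj g _)
    rw [conj_tmul, ← QuotientGroup.mk_mul]
    exact congrArg _ (tmul_mul_right (⟨n, hn⟩ : N) (⟨g, trivial⟩ : (⊤ : Subgroup G))
      (⟨g', trivial⟩ : (⊤ : Subgroup G)))
  act_h x {n} hn g := by
    rw [dif_pos hn, dif_pos (Subgroup.Normal.conj_mem ‹_› n hn x)]
    change QuotientGroup.mk (NonabelianTensor.conj x _) = _
    rw [conj_tmul]
    rfl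
  bdry_h {n} hn g := by
    rw [dif_pos hn]
    exact bdry_tmul _ _
  h_self {n} hn := by
    rw [dif_pos hn, QuotientGroup.eq_one_iff]
    exact Subgroup.subset_normalClosure ⟨n, hn, trivial, rfl⟩
  closure_eq := by
    rw [← top_le_iff, ← Subgroup.map_top_of_surjective _ (QuotientGroup.mk'_surjective _),
      ← PresentedGroup.closure_range_of, MonoidHom.map_closure, Subgroup.closure_le]
    rintro _ ⟨_, ⟨⟨n, g⟩, rfl⟩, rfl⟩
    exact Subgroup.subset_closure ⟨n, n.2, g, by rw [dif_pos n.2]; rfl⟩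

end NonabelianExterior

/-! ### Powerfulness inside `G`, and the conclusion -/

theorem Subgroup.map_subtype_powSubgroup {G : Type*} [Group G] (N : Subgroup G) (p : ℕ) :
    (powSubgroup N p).map N.subtype = N.powers p := by
  rw [powSubgroup, MonoidHom.map_closure, Subgroup.powers]
  congr 1
  ext y
  constructor
  · rintro ⟨_, ⟨x, rfl⟩, rfl⟩
    exact ⟨x, x.2, rfl⟩
  · rintro ⟨x, hx, rfl⟩
    exact ⟨_, ⟨⟨x, hx⟩, rfl⟩, rfl⟩

theorem IsPowerfulPGroup.commutator_le_powers {p : ℕ} {G : Type*} [Group G] (hp2 : Odd p)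
    {N : Subgroup G} (hN : IsPowerfulPGroup p N) : ⁅N, N⁆ ≤ N.powers p := by
  have hp : p ≠ 2 := by rintro rfl; exact absurd hp2 (by decide)
  have h := Subgroup.map_mono (f := N.subtype) hN.2
  rwa [if_neg hp, N.map_subtype_powSubgroup, commutator_def, Subgroup.map_commutator,
    ← MonoidHom.range_eq_map, N.range_subtype] at h

theorem mainTheorem8 (p : ℕ) (hp : p.Prime) (hp2 : Odd p) {G : Type*} [Group G] [Finite G]
    (hG : IsPGroup p G) (N : Subgroup G) [N.Normal] (hN : IsPowerfulPGroup p N) :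
    Monoid.exponent (NonabelianExterior N (⊤ : Subgroup G)) ∣ Monoid.exponent N := by
  have := Fact.mk hp
  obtain ⟨n, hn⟩ := IsPGroup.iff_card.1 (hG.to_subgroup N)
  -- The exponent of `N` divides its order `p ^ n`, hence is itself a power of `p`.
  obtain ⟨e, -, he⟩ := (Nat.dvd_prime_pow hp).1 (hn ▸ Group.exponent_dvd_nat_card (G := N))
  rw [he]
  refine Monoid.exponent_dvd_of_forall_pow_eq_one fun t =>
    (NonabelianExterior.pairing N).pow_eq_one hp hp2 hG (hN.commutator_le_powers hp2) ?_ t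
  intro x hx
  have := Monoid.pow_exponent_eq_one (⟨x, hx⟩ : N)
  rw [he] at this
  exact congrArg Subtype.val this
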